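/- Let $(X,\mathcal B,\mu)$ be a standard (Borel), non-atomic probability space, and let $f:X\to\mathbb R$ be a bounded $\mu$-measurable function. Then there exists an invertible measure-preserving transformation $T$ of $(X,\mathcal B,\mu)$ that is a Bernoulli transformation, i.e. $T=\varphi^{-1}\circ S\circ\varphi$ $\mu$-almost everywhere, where $S$ is the two-sided shift on $(A^{\mathbb Z},p^{\mathbb Z})$ for some finite alphabet $A$ and probability distribution $p$ on $A$, and $\varphi:X\to A^{\mathbb Z}$ is a measure-preserving isomorphism modulo null sets, such that the following holds. For every real $\alpha>1/2$, every sequence $(v_n)_{n\ge 1}$ of integers and every sequence $(L_n)_{n\ge 1}$ of positive integers with $L_n\ge n^{\alpha}$ for all $n\ge 1$, the moving averages converge: $$\lim_{n\to\infty} M(v_n,L_n)^T f(x)=\lim_{n\to\infty}\frac1{L_n}\sum_{i=v_n+1}^{v_n+L_n} f(T^i x)=\int_X f\,d\mu\qquad\text{for }\mu\text{-almost every }x\in X .$$ -/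

import Mathlib

open MeasureTheory Filter Topology

/-- The left shift on two-sided sequences: `(shift x) i = x (i + 1)`. -/
def shift {A : Type*} (x : ℤ → A) : ℤ → A := fun i => x (i + 1)

/-- The law of a two-sided i.i.d. sequence of letters with distribution `p` on a finite alphabet:
the product measure `p^ℤ`. -/
noncomputable def bernoulliMeasure {k : ℕ} (p : PMF (Fin k)) : Measure (ℤ → Fin k) :=
  Measure.infinitePi (fun _ : ℤ => p.toMeasure)

/-- An invertible transformation `T` of `(X, μ)` is a *Bernoulli transformation* if it is
measure preserving and isomorphic modulo null sets to a Bernoulli shift over a finite alphabet: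
there is a measure-preserving map `φ` onto the shift space with measure-preserving almost
everywhere inverse `ψ` such that `T = ψ ∘ shift ∘ φ` almost everywhere. -/
def IsBernoulli {X : Type*} [MeasurableSpace X] (μ : Measure X) (T : X ≃ᵐ X) : Prop :=
  MeasurePreserving T μ μ ∧
    ∃ (k : ℕ) (p : PMF (Fin k)) (φ : X → (ℤ → Fin k)) (ψ : (ℤ → Fin k) → X),
      MeasurePreserving φ μ (bernoulliMeasure p) ∧
      MeasurePreserving ψ (bernoulliMeasure p) μ ∧
      (∀ᵐ x ∂μ, ψ (φ x) = x) ∧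
      (∀ᵐ y ∂(bernoulliMeasure p), φ (ψ y) = y) ∧
      ∀ᵐ x ∂μ, T x = ψ (shift (φ x))

/-- The moving average `M(v, L)^T f = (1 / L) ∑_{i = v + 1}^{v + L} f ∘ T^i`, where `v` is any
integer and `T` is invertible. -/
noncomputable def movingAverage {X : Type*} [MeasurableSpace X] (T : X ≃ᵐ X) (f : X → ℝ)
    (v : ℤ) (L : ℕ) (x : X) : ℝ :=
  (1 / (L : ℝ)) * ∑ i ∈ Finset.Ioc v (v + (L : ℤ)), f (((T.toEquiv : Equiv.Perm X) ^ i) x)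

/-! The freedom lies in choosing `T`: identify `X` with the fair-coin shift space so that `f`
becomes an almost everywhere continuous function `V`, and transport the shift. Such a `V` is
squeezed between functions of finitely many coordinates with nearly the same integral. For these,
Hoeffding's inequality makes a deviation of the average exponentially unlikely in `L n`, whatever `v
n` is, so Borel–Cantelli suffices (`measureReal_window_sum_ge_le`,
`ae_tendsto_average_of_ae_continuousAt`). For the identification (`exists_iso_ae_continuousAt`),
write `f = W ∘ h` with `W` continuous and `h` an injective coordinate in the unit interval. The
quantile function of the law of `h` is monotone, so in Lebesgue coordinates `f` is `W` of a monotone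
function, which has countably many discontinuities. A continuous map from the coin space onto
Lebesgue measure pulls this back. -/

instance bernoulliMeasure.instIsProbabilityMeasure {k : ℕ} (p : PMF (Fin k)) :
    IsProbabilityMeasure (bernoulliMeasure p) := by
  unfold bernoulliMeasure; infer_instance

/-! ### Independence and concentration for window functions -/

/-- The law of a sequence read along an injective reindexing is again a product measure. -/
lemma bernoulliMeasure_map_comp {k : ℕ} (p : PMF (Fin k)) {ι : Type*} {e : ι → ℤ}
    (he : Function.Injective e) :
    (bernoulliMeasure p).map (fun ω i => ω (e i)) = Measure.infinitePi fun _ : ι => p.toMeasure :=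
  Measure.map_infinitePi_infinitePi_of_inj (P := fun _ : ℤ => p.toMeasure) he

/-- Windows of length `m` starting at distinct congruent positions are disjoint: the residue of a
point gives its offset, hence its window. -/
lemma injective_add_fin_of_emod_eq (m : ℕ) (r : ℤ) :
    Function.Injective fun q : {i : ℤ // i % m = r} × Fin m => (q.1 : ℤ) + (q.2 : ℕ) := by
  rintro ⟨⟨i, hi⟩, b⟩ ⟨⟨i', hi'⟩, b'⟩ h
  simp only at h
  have hd : ((b : ℕ) : ℤ) % m = ((b' : ℕ) : ℤ) % m := by
    apply Int.ModEq.add_left_cancel (a := i) (b := i') (n := m) (hi.trans hi'.symm)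
    rw [h]
  have hb := b.isLt
  have hb' := b'.isLt
  rw [Int.emod_eq_of_lt (by omega) (by omega), Int.emod_eq_of_lt (by omega) (by omega)] at hd
  have hbb : b = b' := Fin.ext (by omega)
  subst hbb
  simpa using h

/-- Window functions read at positions that are congruent modulo the window length are
independent. -/
lemma iIndepFun_window {k : ℕ} (p : PMF (Fin k)) (m : ℕ) (γ : (Fin m → Fin k) → ℝ) (r : ℤ) :
    ProbabilityTheory.iIndepFun
      (fun (i : {i : ℤ // i % m = r}) (ω : ℤ → Fin k) => γ fun b => ω (i + (b : ℕ)))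
      (bernoulliMeasure p) := by
  have hγ : Measurable γ := measurable_of_countable γ
  have hX : ProbabilityTheory.iIndepFun
      (fun (i : {i : ℤ // i % m = r}) (ω : {i : ℤ // i % m = r} → Fin m → Fin k) => γ (ω i))
      (Measure.infinitePi fun _ : {i : ℤ // i % m = r} =>
        Measure.infinitePi fun _ : Fin m => p.toMeasure) :=
    ProbabilityTheory.iIndepFun_infinitePi (X := fun _ => γ) fun _ => hγ
  have hmap : (bernoulliMeasure p).map
      (fun ω (i : {i : ℤ // i % m = r}) (b : Fin m) => ω (i + (b : ℕ))) =
      Measure.infinitePi fun _ : {i : ℤ // i % m = r} =>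
        Measure.infinitePi fun _ : Fin m => p.toMeasure := by
    rw [← Measure.infinitePi_map_curry, ← bernoulliMeasure_map_comp p
      (injective_add_fin_of_emod_eq m r), Measure.map_map (by fun_prop) (by fun_prop)]
    rfl
  rw [← hmap] at hX
  rw [ProbabilityTheory.iIndepFun_iff_measure_inter_preimage_eq_mul] at hX ⊢
  intro S sets hsets
  have hm : Measurable
      (fun (ω : ℤ → Fin k) (i : {i : ℤ // i % m = r}) (b : Fin m) => ω (i + (b : ℕ))) := by
    fun_prop
  have h1 := hX S hsets
  rw [Measure.map_apply hm] at h1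
  · refine Eq.trans ?_ (h1.trans ?_)
    · simp only [Set.preimage_iInter]; rfl
    · refine Finset.prod_congr rfl fun i hi => ?_
      rw [Measure.map_apply hm]
      · rfl
      · exact (hγ.comp (measurable_pi_apply i)) (hsets i hi)
  · exact S.measurableSet_biInter fun i hi => (hγ.comp (measurable_pi_apply i)) (hsets i hi)

lemma integral_window {k : ℕ} (p : PMF (Fin k)) (m : ℕ) (γ : (Fin m → Fin k) → ℝ) (i : ℤ) :
    ∫ ω, γ (fun b => ω (i + (b : ℕ))) ∂(bernoulliMeasure p) =
      ∫ y, γ y ∂(Measure.infinitePi fun _ : Fin m => p.toMeasure) := by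
  rw [← bernoulliMeasure_map_comp p (e := fun b : Fin m => i + ((b : ℕ) : ℤ))
    (fun a b h => Fin.ext (by simpa using h)), integral_map]
  · exact (by fun_prop : Measurable _).aemeasurable
  · exact (measurable_of_countable γ).aestronglyMeasurable

/-- Hoeffding's bound for sums of a window function along an interval of positions. -/
lemma measureReal_window_sum_ge_le {k : ℕ} (p : PMF (Fin k)) {m : ℕ} (hm : 0 < m)
    (γ : (Fin m → Fin k) → ℝ) {C : ℝ} (hC : 0 < C) (hγ : ∀ y, |γ y| ≤ C) {ε : ℝ} (hε : 0 < ε)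
    (v : ℤ) {L : ℕ} (hL : 0 < L) :
    (bernoulliMeasure p).real {ω | ε * L ≤ ∑ i ∈ Finset.Ioc v (v + (L : ℤ)),
        (γ (fun b => ω (i + (b : ℕ))) -
          ∫ y, γ y ∂(Measure.infinitePi fun _ : Fin m => p.toMeasure))} ≤
      m * Real.exp (-(ε ^ 2 / (2 * m ^ 2 * C ^ 2)) * L) := by
  set E := ∫ y, γ y ∂(Measure.infinitePi fun _ : Fin m => p.toMeasure)
  set X : ℤ → (ℤ → Fin k) → ℝ := fun i ω => γ (fun b => ω (i + (b : ℕ))) - E with hX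
  set A : ℕ → Finset ℤ := fun r => (Finset.Ioc v (v + (L : ℤ))).filter fun i => i % m = (r : ℤ)
    with hA
  have hm0 : (0 : ℝ) < m := by exact_mod_cast hm
  have hL0 : (0 : ℝ) < L := by exact_mod_cast hL
  -- Overlapping windows are dependent, so the sum is split into residue classes; a total of at
  -- least `ε * L` forces some class to reach `ε * L / m`.
  have hsum : ∀ ω, ∑ i ∈ Finset.Ioc v (v + (L : ℤ)), X i ω =
      ∑ r ∈ Finset.range m, ∑ i ∈ A r, X i ω := by
    intro ω
    rw [← Finset.sum_fiberwise_of_maps_to (g := fun i : ℤ => (i % m).toNat)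
      (t := Finset.range m)]
    · refine Finset.sum_congr rfl fun r _ => Finset.sum_congr ?_ fun _ _ => rfl
      refine Finset.filter_congr fun i _ => ?_
      have := Int.emod_nonneg i (b := (m : ℤ)) (by omega)
      omega
    · intro i _
      have := Int.emod_nonneg i (b := (m : ℤ)) (by omega)
      have := Int.emod_lt_of_pos i (b := (m : ℤ)) (by omega)
      simp only [Finset.mem_range]
      omega
  have hone : ∀ r : ℕ, (bernoulliMeasure p).real {ω | ε * L / m ≤ ∑ i ∈ A r, X i ω} ≤
      Real.exp (-(ε ^ 2 / (2 * m ^ 2 * C ^ 2)) * L) := by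
    intro r
    -- The empty class is set aside because Hoeffding's exponent divides by the number of terms.
    by_cases hAr : A r = ∅
    · have : {ω | ε * L / m ≤ ∑ i ∈ A r, X i ω} = ∅ := by
        ext ω
        have : 0 < ε * L / m := by positivity
        simp [hAr, this]
      rw [this]
      simp [Real.exp_nonneg]
    have hind := (iIndepFun_window p m γ (r : ℤ)).comp (fun _ => fun x => x - E)
      (fun _ => by fun_prop)
    have hsub : ∀ i ∈ (Finset.Ioc v (v + (L : ℤ))).subtype (fun i => i % m = (r : ℤ)),
        ProbabilityTheory.HasSubgaussianMGF
          (((fun x => x - E) : ℝ → ℝ) ∘ fun ω : ℤ → Fin k => γ fun b => ω (i + (b : ℕ)))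
          ((‖C - -C‖₊ / 2) ^ 2) (bernoulliMeasure p) := by
      intro i _
      have h := ProbabilityTheory.hasSubgaussianMGF_of_mem_Icc (μ := bernoulliMeasure p)
        (X := fun ω : ℤ → Fin k => γ fun b => ω (i + (b : ℕ))) (a := -C) (b := C)
        (((measurable_of_countable γ).comp (by fun_prop)).aemeasurable)
        (ae_of_all _ fun ω => abs_le.1 (hγ _))
      rw [integral_window] at h
      exact h
    have h := ProbabilityTheory.HasSubgaussianMGF.measure_sum_ge_le_of_iIndepFun hind
      (c := fun _ => (‖C - -C‖₊ / 2) ^ 2) hsub (ε := ε * L / m) (by positivity)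
    have hset : {ω | ε * L / m ≤ ∑ i ∈ A r, X i ω} = {ω | ε * L / m ≤
        ∑ i ∈ (Finset.Ioc v (v + (L : ℤ))).subtype (fun i => i % m = (r : ℤ)),
          (((fun x => x - E) : ℝ → ℝ) ∘ fun ω : ℤ → Fin k => γ fun b => ω (i + (b : ℕ))) ω} := by
      ext ω
      have := Finset.sum_subtype_eq_sum_filter (s := Finset.Ioc v (v + (L : ℤ)))
        (fun i => X i ω) (p := fun i => i % m = (r : ℤ))
      simp only [Set.mem_ofPred_eq, hA, ← this]
      rfl
    rw [hset]
    refine h.trans (Real.exp_le_exp.2 ?_)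
    have hcard : ((Finset.Ioc v (v + (L : ℤ))).subtype (fun i => i % m = (r : ℤ))).card ≤ L := by
      rw [Finset.card_subtype]
      refine (Finset.card_filter_le _ _).trans ?_
      simp
    have hcard0 : 0 < ((Finset.Ioc v (v + (L : ℤ))).subtype (fun i => i % m = (r : ℤ))).card := by
      rw [Finset.card_subtype]
      exact Finset.card_pos.2 (Finset.nonempty_iff_ne_empty.2 hAr)
    have hC' : ((‖C - -C‖₊ / 2 : NNReal) : ℝ) = C := by
      push_cast
      rw [Real.norm_of_nonneg (by linarith)]
      ring
    simp only [Finset.sum_const, nsmul_eq_mul]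
    push_cast at hC' ⊢
    rw [hC']
    set N : ℝ := (((Finset.Ioc v (v + (L : ℤ))).subtype (fun i => i % m = (r : ℤ))).card : ℝ)
    have hN0 : 0 < N := Nat.cast_pos.2 hcard0
    have hNL : N ≤ L := Nat.cast_le.2 hcard
    rw [neg_div, neg_mul, neg_le_neg_iff, le_div_iff₀ (by positivity)]
    have : ε ^ 2 / (2 * m ^ 2 * C ^ 2) * L * (2 * (N * C ^ 2)) = ε ^ 2 * L / m ^ 2 * N := by
      field_simp
    rw [this]
    calc ε ^ 2 * L / m ^ 2 * N ≤ ε ^ 2 * L / m ^ 2 * L := by gcongr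
      _ = (ε * L / m) ^ 2 := by ring
  have hsubset : {ω | ε * L ≤ ∑ i ∈ Finset.Ioc v (v + (L : ℤ)), X i ω} ⊆
      ⋃ r ∈ Finset.range m, {ω | ε * L / m ≤ ∑ i ∈ A r, X i ω} := by
    intro ω hω
    by_contra hcon
    simp only [Set.mem_iUnion, Set.mem_ofPred_eq, not_exists, not_le] at hcon hω
    rw [hsum] at hω
    have := Finset.sum_lt_sum_of_nonempty (s := Finset.range m) (by simpa using hm.ne')
      fun r hr => hcon r hr
    rw [Finset.sum_const, Finset.card_range, nsmul_eq_mul, mul_div_cancel₀ _ hm0.ne'] at this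
    linarith
  calc _ ≤ (bernoulliMeasure p).real (⋃ r ∈ Finset.range m, {ω | ε * L / m ≤ ∑ i ∈ A r, X i ω}) :=
        measureReal_mono hsubset (measure_ne_top _ _)
    _ ≤ ∑ r ∈ Finset.range m, (bernoulliMeasure p).real {ω | ε * L / m ≤ ∑ i ∈ A r, X i ω} :=
        measureReal_biUnion_finset_le _ _
    _ ≤ ∑ r ∈ Finset.range m, Real.exp (-(ε ^ 2 / (2 * m ^ 2 * C ^ 2)) * L) :=
        Finset.sum_le_sum fun r _ => hone r
    _ = _ := by simp

/-- Since `exp x ≥ x ^ 2 / 2`, the terms are at most a constant times `n ^ (-2 * α)`; this is where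
`α > 1/2` enters. -/
lemma summable_exp_neg_mul_of_rpow_le {c α : ℝ} (hc : 0 < c) (hα : 1 / 2 < α) {L : ℕ → ℕ}
    (hL : ∀ n : ℕ, 1 ≤ n → (n : ℝ) ^ α ≤ (L n : ℝ)) :
    Summable fun n => Real.exp (-c * L n) := by
  have hs : Summable fun n : ℕ => 2 / c ^ 2 * (1 / (n : ℝ) ^ (2 * α)) :=
    (Real.summable_one_div_nat_rpow.2 (by linarith)).mul_left _
  refine Summable.of_norm_bounded_eventually_nat hs ?_
  filter_upwards [eventually_ge_atTop 1] with n hn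
  have hn0 : (0 : ℝ) < n := by exact_mod_cast hn
  have hx : 0 < (n : ℝ) ^ α := Real.rpow_pos_of_pos hn0 _
  have hLn := hL n hn
  rw [Real.norm_of_nonneg (Real.exp_nonneg _)]
  have h2 : (n : ℝ) ^ (2 * α) = ((n : ℝ) ^ α) ^ 2 := by
    rw [mul_comm, Real.rpow_mul hn0.le]; norm_cast
  rw [h2, neg_mul, Real.exp_neg, ← one_div, div_mul_div_comm, mul_one]
  have hq := Real.quadratic_le_exp_of_nonneg (x := c * L n) (by positivity)
  have hle : c ^ 2 * ((n : ℝ) ^ α) ^ 2 ≤ c ^ 2 * (L n : ℝ) ^ 2 := by gcongr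
  rw [div_le_div_iff₀ (Real.exp_pos _) (by positivity)]
  nlinarith [mul_nonneg hc.le (Nat.cast_nonneg (α := ℝ) (L n))]

/-- Borel–Cantelli applied to the Hoeffding bounds. -/
lemma ae_eventually_window_sum_lt {k : ℕ} (p : PMF (Fin k)) {m : ℕ} (hm : 0 < m)
    (γ : (Fin m → Fin k) → ℝ) {α : ℝ} (hα : 1 / 2 < α) (v : ℕ → ℤ) {L : ℕ → ℕ}
    (hL : ∀ n : ℕ, 1 ≤ n → (n : ℝ) ^ α ≤ (L n : ℝ)) {ε : ℝ} (hε : 0 < ε) :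
    ∀ᵐ ω ∂(bernoulliMeasure p), ∀ᶠ n in atTop,
      ∑ i ∈ Finset.Ioc (v n) (v n + (L n : ℤ)), (γ (fun b => ω (i + (b : ℕ))) -
        ∫ y, γ y ∂(Measure.infinitePi fun _ : Fin m => p.toMeasure)) < ε * L n := by
  obtain ⟨C, hC, hγ⟩ : ∃ C : ℝ, 0 < C ∧ ∀ y, |γ y| ≤ C := by
    obtain ⟨M, hM⟩ := (Set.finite_range fun y => |γ y|).bddAbove
    exact ⟨max M 1, by positivity, fun y => (hM ⟨y, rfl⟩).trans (le_max_left _ _)⟩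
  have hm0 : (0 : ℝ) < m := by exact_mod_cast hm
  set c := ε ^ 2 / (2 * m ^ 2 * C ^ 2) with hc
  have hc0 : 0 < c := by positivity
  have hsumm : Summable fun n => (m : ℝ) * Real.exp (-c * L n) :=
    (summable_exp_neg_mul_of_rpow_le hc0 hα hL).mul_left _
  -- The clause `1 ≤ n` empties the event at index 0, where `L 0` may vanish.
  set s : ℕ → Set (ℤ → Fin k) := fun n => {ω | 1 ≤ n ∧ ε * L n ≤
    ∑ i ∈ Finset.Ioc (v n) (v n + (L n : ℤ)), (γ (fun b => ω (i + (b : ℕ))) -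
        ∫ y, γ y ∂(Measure.infinitePi fun _ : Fin m => p.toMeasure))} with hs
  have hbound : ∀ n, bernoulliMeasure p (s n) ≤
      ENNReal.ofReal ((m : ℝ) * Real.exp (-c * L n)) := by
    intro n
    by_cases hn : 1 ≤ n
    · rw [← ofReal_measureReal]
      refine ENNReal.ofReal_le_ofReal ?_
      have hn0 : (0 : ℝ) < n := by exact_mod_cast hn
      have hLn : 0 < L n := by
        have := (Real.rpow_pos_of_pos hn0 α).trans_le (hL n hn)
        exact_mod_cast this
      refine le_trans (measureReal_mono ?_) (measureReal_window_sum_ge_le p hm γ hC hγ hε (v n) hLn)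
      exact fun ω hω => hω.2
    · simp [hs, hn]
  have hfin : ∑' n, bernoulliMeasure p (s n) ≠ ⊤ :=
    ne_top_of_le_ne_top hsumm.tsum_ofReal_ne_top (ENNReal.tsum_le_tsum hbound)
  filter_upwards [ae_eventually_notMem hfin] with ω hω
  filter_upwards [hω, eventually_ge_atTop 1] with n hn h1
  simp only [hs, Set.mem_ofPred_eq, not_and, not_le] at hn
  exact hn h1

/-- Moving averages of window functions with lengths growing at least like `n ^ α`, `α > 1/2`,
converge almost surely along a Bernoulli shift. -/
lemma ae_tendsto_window_average {k : ℕ} (p : PMF (Fin k)) {m : ℕ} (hm : 0 < m)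
    (γ : (Fin m → Fin k) → ℝ) {α : ℝ} (hα : 1 / 2 < α) (v : ℕ → ℤ) {L : ℕ → ℕ}
    (hL : ∀ n : ℕ, 1 ≤ n → (n : ℝ) ^ α ≤ (L n : ℝ)) :
    ∀ᵐ ω ∂(bernoulliMeasure p), Tendsto (fun n => (1 / (L n : ℝ)) *
      ∑ i ∈ Finset.Ioc (v n) (v n + (L n : ℤ)), γ (fun b => ω (i + (b : ℕ)))) atTop
      (𝓝 (∫ y, γ y ∂(Measure.infinitePi fun _ : Fin m => p.toMeasure))) := by
  set E := ∫ y, γ y ∂(Measure.infinitePi fun _ : Fin m => p.toMeasure) with hE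
  have hup := fun j : ℕ => ae_eventually_window_sum_lt p hm γ hα v hL
    (Nat.one_div_pos_of_nat (α := ℝ) (n := j))
  have hlow := fun j : ℕ => ae_eventually_window_sum_lt p hm (fun y => -γ y) hα v hL
    (Nat.one_div_pos_of_nat (α := ℝ) (n := j))
  filter_upwards [ae_all_iff.2 hup, ae_all_iff.2 hlow] with ω h1 h2
  rw [Metric.tendsto_nhds]
  intro ε hε
  obtain ⟨j, hj⟩ := exists_nat_one_div_lt hε
  filter_upwards [h1 j, h2 j, eventually_ge_atTop 1] with n hn1 hn2 hn
  have hn0 : (0 : ℝ) < n := by exact_mod_cast hn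
  have hLn : (0 : ℝ) < L n := (Real.rpow_pos_of_pos hn0 α).trans_le (hL n hn)
  simp only [integral_neg, Finset.sum_sub_distrib, Finset.sum_const, Int.card_Ioc,
    add_sub_cancel_left, Int.toNat_natCast, nsmul_eq_mul, Finset.sum_neg_distrib, ← hE] at hn1 hn2
  set S := ∑ i ∈ Finset.Ioc (v n) (v n + (L n : ℤ)), γ (fun b => ω (i + (b : ℕ)))
  rw [Real.dist_eq]
  refine lt_trans ?_ hj
  have : 1 / (L n : ℝ) * S - E = (S - L n * E) / L n := by field_simp
  rw [this, abs_div, abs_of_pos hLn, div_lt_iff₀ hLn, abs_lt]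
  constructor <;> linarith

/-! ### From window functions to almost everywhere continuous functions -/

/-- One-sided estimate: moving averages of an almost everywhere continuous bounded function are
eventually at most slightly above its mean. -/
lemma ae_eventually_average_lt {k : ℕ} (p : PMF (Fin k)) {V : (ℤ → Fin k) → ℝ}
    {C : ℝ} (hC : ∀ ω, |V ω| ≤ C)
    (hcont : ∀ᵐ ω ∂(bernoulliMeasure p), ContinuousAt V ω)
    {α : ℝ} (hα : 1 / 2 < α) (v : ℕ → ℤ) {L : ℕ → ℕ}
    (hL : ∀ n : ℕ, 1 ≤ n → (n : ℝ) ^ α ≤ (L n : ℝ)) :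
    ∀ᵐ ω ∂(bernoulliMeasure p), ∀ ε > 0, ∀ᶠ n in atTop, (1 / (L n : ℝ)) *
      ∑ i ∈ Finset.Ioc (v n) (v n + (L n : ℤ)), V (fun j => ω (j + i)) <
      ∫ ω, V ω ∂(bernoulliMeasure p) + ε := by
  -- The supremum of `V` over the cylinder fixing coordinates `-K, ..., K`: a window function above
  -- `V` that tends to `V` at each continuity point.
  set γ : (K : ℕ) → (Fin (2 * K + 1) → Fin k) → ℝ := fun K y =>
    sSup (V '' {ω' | ∀ b : Fin (2 * K + 1), ω' (-K + ((b : ℕ) : ℤ)) = y b}) with hγ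
  set U : ℕ → (ℤ → Fin k) → ℝ := fun K ω => γ K fun b => ω (-K + ((b : ℕ) : ℤ)) with hU
  have hbdd : ∀ S : Set (ℤ → Fin k), BddAbove (V '' S) := fun S =>
    ⟨C, by rintro _ ⟨ω, -, rfl⟩; exact (abs_le.1 (hC ω)).2⟩
  have hVU : ∀ K ω, V ω ≤ U K ω := fun K ω => le_csSup (hbdd _) ⟨ω, fun _ => rfl, rfl⟩
  have hUC : ∀ K ω, |U K ω| ≤ C := fun K ω => abs_le.2
    ⟨(abs_le.1 (hC ω)).1.trans (hVU K ω), csSup_le ⟨_, ω, fun _ => rfl, rfl⟩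
      (by rintro _ ⟨ω', -, rfl⟩; exact (abs_le.1 (hC ω')).2)⟩
  have hUlim : ∀ ω, ContinuousAt V ω → Tendsto (fun K => U K ω) atTop (𝓝 (V ω)) := by
    intro ω hω
    rw [Metric.tendsto_atTop]
    intro ε hε
    have hnb : {ω' | V ω' < V ω + ε / 2} ∈ 𝓝 ω :=
      hω.eventually (gt_mem_nhds (by linarith))
    rw [nhds_pi, Filter.mem_pi] at hnb
    obtain ⟨I, hI, t, ht, hsub⟩ := hnb
    obtain ⟨N, hN⟩ : ∃ N : ℕ, ∀ i ∈ I, |i| ≤ N := by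
      obtain ⟨M, hM⟩ := (hI.image fun i : ℤ => i.natAbs).bddAbove
      refine ⟨M, fun i hi => ?_⟩
      have := hM ⟨i, hi, rfl⟩
      simp only at this
      rw [Int.abs_eq_natAbs]
      exact_mod_cast this
    refine ⟨N, fun K hK => ?_⟩
    have hle : U K ω ≤ V ω + ε / 2 := by
      refine csSup_le ⟨_, ω, fun _ => rfl, rfl⟩ ?_
      rintro _ ⟨ω', hω', rfl⟩
      have hmem : ω' ∈ {ω' | V ω' < V ω + ε / 2} := by
        refine hsub fun i hi => ?_
        have hiN := abs_le.1 (hN i hi)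
        have hlt : (i + K).toNat < 2 * K + 1 := by omega
        have h := hω' ⟨(i + K).toNat, hlt⟩
        have hi' : -(K : ℤ) + (((i + K).toNat : ℕ) : ℤ) = i := by omega
        simp only [hi'] at h
        rw [h]
        exact mem_of_mem_nhds (ht i)
      exact hmem.le
    rw [Real.dist_eq, abs_lt]
    have := hVU K ω
    constructor <;> linarith
  have hUint : Tendsto (fun K => ∫ ω, U K ω ∂(bernoulliMeasure p)) atTop
      (𝓝 (∫ ω, V ω ∂(bernoulliMeasure p))) := by
    refine tendsto_integral_of_dominated_convergence (fun _ => C) (fun K => ?_)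
      (integrable_const C) (fun K => ae_of_all _ fun ω => hUC K ω) ?_
    · exact ((measurable_of_countable (γ K)).comp (by fun_prop)).aestronglyMeasurable
    · filter_upwards [hcont] with ω hω using hUlim ω hω
  -- A window centred at `i` starts at `i - K`, hence the translated `v`.
  have hUavg := fun K : ℕ => ae_tendsto_window_average p (Nat.succ_pos (2 * K)) (γ K) hα
    (fun n => v n + -(K : ℤ)) hL
  filter_upwards [ae_all_iff.2 hUavg] with ω hω ε hε
  obtain ⟨K, hK⟩ := (hUint.eventually (gt_mem_nhds (show ∫ ω, V ω ∂(bernoulliMeasure p) <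
    ∫ ω, V ω ∂(bernoulliMeasure p) + ε by linarith))).exists
  have hE : ∫ ω, U K ω ∂(bernoulliMeasure p) =
      ∫ y, γ K y ∂(Measure.infinitePi fun _ : Fin (2 * K + 1) => p.toMeasure) :=
    integral_window p _ (γ K) _
  rw [hE] at hK
  filter_upwards [(hω K).eventually (gt_mem_nhds hK)] with n hn
  refine lt_of_le_of_lt ?_ hn
  refine mul_le_mul_of_nonneg_left ?_ (by positivity)
  have hIoc : Finset.Ioc (v n + -(K : ℤ)) (v n + -(K : ℤ) + (L n : ℤ)) =
      (Finset.Ioc (v n) (v n + (L n : ℤ))).map (addRightEmbedding (-(K : ℤ))) := by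
    rw [Finset.map_add_right_Ioc]
    congr 1
    ring
  rw [hIoc, Finset.sum_map]
  refine Finset.sum_le_sum fun i _ => (hVU K _).trans_eq ?_
  simp only [hU, addRightEmbedding_apply]
  congr 1
  ext b
  congr 2
  ring

/-- Moving averages of bounded almost everywhere continuous functions with lengths growing at
least like `n ^ α`, `α > 1/2`, converge almost surely along a Bernoulli shift. -/
lemma ae_tendsto_average_of_ae_continuousAt {k : ℕ} (p : PMF (Fin k)) {V : (ℤ → Fin k) → ℝ}
    {C : ℝ} (hC : ∀ ω, |V ω| ≤ C)
    (hcont : ∀ᵐ ω ∂(bernoulliMeasure p), ContinuousAt V ω)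
    {α : ℝ} (hα : 1 / 2 < α) (v : ℕ → ℤ) {L : ℕ → ℕ}
    (hL : ∀ n : ℕ, 1 ≤ n → (n : ℝ) ^ α ≤ (L n : ℝ)) :
    ∀ᵐ ω ∂(bernoulliMeasure p), Tendsto (fun n => (1 / (L n : ℝ)) *
      ∑ i ∈ Finset.Ioc (v n) (v n + (L n : ℤ)), V (fun j => ω (j + i))) atTop
      (𝓝 (∫ ω, V ω ∂(bernoulliMeasure p))) := by
  filter_upwards [ae_eventually_average_lt p hC hcont hα v hL,
    ae_eventually_average_lt p (V := fun ω => -V ω) (C := C) (by simpa using hC)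
      (hcont.mono fun ω h => h.neg) hα v hL] with ω h1 h2
  rw [Metric.tendsto_nhds]
  intro ε hε
  filter_upwards [h1 ε hε, h2 ε hε] with n hn1 hn2
  simp only [Finset.sum_neg_distrib, integral_neg, mul_neg] at hn2
  rw [Real.dist_eq, abs_lt]
  constructor <;> linarith

/-! ### Coordinates on the unit interval -/

/-- A measurable left inverse of a measure-preserving map is measure preserving. -/
lemma MeasurePreserving.of_leftInverse {α β : Type*} [MeasurableSpace α] [MeasurableSpace β]
    {μ : Measure α} {ν : Measure β} {a : α → β} {b : β → α} (ha : MeasurePreserving a μ ν)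
    (hb : Measurable b) (hab : ∀ᵐ x ∂μ, b (a x) = x) : MeasurePreserving b ν μ := by
  refine ⟨hb, ?_⟩
  rw [← ha.map_eq, Measure.map_map hb ha.measurable,
    Measure.map_congr (g := id) (by filter_upwards [hab] with x hx using hx), Measure.map_id]

/-- A measurable left inverse of a measure-preserving map is almost everywhere a right inverse. -/
lemma MeasurePreserving.ae_rightInverse_of_leftInverse {α β : Type*} [MeasurableSpace α]
    [MeasurableSpace β] [MeasurableEq β] {μ : Measure α} {ν : Measure β} {a : α → β} {b : β → α}
    (ha : MeasurePreserving a μ ν) (hb : Measurable b) (hab : ∀ᵐ x ∂μ, b (a x) = x) :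
    ∀ᵐ y ∂ν, a (b y) = y := by
  have hset : MeasurableSet {y | a (b y) = y} :=
    measurableSet_eq_fun (ha.measurable.comp hb) measurable_id
  rw [← ha.map_eq, ae_map_iff ha.measurable.aemeasurable hset]
  filter_upwards [hab] with x hx
  simp [hx]

open unitInterval in
/-- Quantile transform of a diffuse probability measure on the unit interval. -/
lemma exists_quantile (m : Measure I) [IsProbabilityMeasure m] [NullSingletonClass m] :
    ∃ q H : I → I, Monotone q ∧ Continuous H ∧ MeasurePreserving q volume m ∧
      ∀ t, H (q t) = t := by
  have hmem : ∀ s : I, m.real (Set.Icc 0 s) ∈ I := fun s =>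
    ⟨measureReal_nonneg, measureReal_le_one⟩
  set H : I → I := fun s => ⟨m.real (Set.Icc 0 s), hmem s⟩ with hH
  have : IsProbabilityMeasure (m.map Subtype.val) :=
    Measure.isProbabilityMeasure_map measurable_subtype_coe.aemeasurable
  have hcdf : Continuous (ProbabilityTheory.cdf (m.map Subtype.val)) := by
    set F := ProbabilityTheory.cdf (m.map Subtype.val)
    refine continuous_iff_continuousAt.2 fun x => ?_
    have h0 : F.measure {x} = 0 := by
      rw [ProbabilityTheory.measure_cdf, Measure.map_apply measurable_subtype_coe
        (measurableSet_singleton x)]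
      exact Set.Subsingleton.measure_zero
        (fun a ha b hb => Subtype.ext (ha.trans hb.symm)) m
    rw [StieltjesFunction.measure_singleton, ENNReal.ofReal_eq_zero, sub_nonpos] at h0
    rw [F.mono.continuousAt_iff_leftLim_eq_rightLim, F.rightLim_eq]
    exact le_antisymm (F.mono.leftLim_le le_rfl) h0
  have hHc : Continuous H := by
    refine Continuous.subtype_mk ?_ _
    simp_rw [← ProbabilityTheory.unitInterval.cdf_eq_real]
    exact hcdf.comp continuous_subtype_val
  have hHm : Monotone H := fun s t hst => by
    simp only [hH, Subtype.mk_le_mk]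
    exact measureReal_mono (Set.Icc_subset_Icc_right hst)
  have hH0 : H 0 = 0 := by simp [hH, Measure.real]
  have hH1 : H 1 = 1 := by
    have : Set.Icc (0 : I) 1 = Set.univ := by ext x; simpa using Subtype.coe_le_coe.1 x.2.2
    simp only [hH, this, probReal_univ]
    rfl
  set q : I → I := fun t => sInf {s | t ≤ H s} with hq
  -- Continuity of `H` makes the superlevel set closed, so the infimum defining `q` is attained.
  have hgc : GaloisConnection q H := by
    intro t s
    constructor
    · intro h
      have hcl : IsClosed {s | t ≤ H s} := isClosed_le continuous_const hHc
      have hne : {s | t ≤ H s}.Nonempty := ⟨1, by simp only [Set.mem_ofPred_eq, hH1]; exact t.2.2⟩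
      have := hcl.csInf_mem hne (OrderBot.bddBelow _)
      exact le_trans this (hHm h)
    · intro h
      exact sInf_le h
  have hsurj : Function.Surjective H := by
    intro t
    have := intermediate_value_univ (0 : I) 1 hHc
    rw [hH0, hH1] at this
    exact this ⟨t.2.1, t.2.2⟩
  refine ⟨q, H, hgc.monotone_l, hHc, ⟨hgc.monotone_l.measurable, ?_⟩, fun t => ?_⟩
  · have : IsProbabilityMeasure ((volume : Measure I).map q) :=
      Measure.isProbabilityMeasure_map hgc.monotone_l.measurable.aemeasurable
    refine Measure.ext_of_Iic _ _ fun s => ?_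
    rw [Measure.map_apply hgc.monotone_l.measurable measurableSet_Iic]
    have : q ⁻¹' Set.Iic s = Set.Iic (H s) := by ext t; exact hgc t s
    rw [this, unitInterval.volume_Iic]
    have : Set.Iic s = Set.Icc 0 s := by ext t; simp
    rw [this]
    exact ofReal_measureReal
  · obtain ⟨s, rfl⟩ := hsurj t
    exact hgc.u_l_u_eq_u s

open unitInterval in
/-- An injective measurable coordinate on a diffuse standard Borel probability space identifies it
with the unit interval, with the coordinate becoming a monotone function. -/
lemma exists_unitInterval_iso {Y : Type*} [MeasurableSpace Y] [StandardBorelSpace Y]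
    (μ : Measure Y) [IsProbabilityMeasure μ] [NullSingletonClass μ] {h : Y → I}
    (hh : Measurable h) (hinj : Function.Injective h) :
    ∃ (H q : I → I) (ψ : I → Y), Continuous H ∧ Monotone q ∧
      MeasurePreserving (fun y => H (h y)) μ volume ∧ MeasurePreserving ψ volume μ ∧
      (∀ᵐ y ∂μ, ψ (H (h y)) = y) ∧ (∀ᵐ t, H (h (ψ t)) = t) ∧ ∀ᵐ t, h (ψ t) = q t := by
  have hY : Nonempty Y := nonempty_of_isProbabilityMeasure μ
  have hemb := hh.measurableEmbedding hinj
  -- `g` is a measurable left inverse of `h`, defined on the whole interval.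
  obtain ⟨g, hg, hgh⟩ := hemb.exists_measurable_extend (g := (id : Y → Y)) measurable_id fun _ => hY
  have hgh' : ∀ y, g (h y) = y := fun y => congrFun hgh y
  have hhP : MeasurePreserving h μ (μ.map h) := ⟨hh, rfl⟩
  have : IsProbabilityMeasure (μ.map h) := Measure.isProbabilityMeasure_map hh.aemeasurable
  have : NullSingletonClass (μ.map h) := ⟨fun x => by
    rw [Measure.map_apply hh (measurableSet_singleton x)]
    exact Set.Subsingleton.measure_zero (fun a ha b hb => hinj (ha.trans hb.symm)) μ⟩
  obtain ⟨q, H, hq, hH, hqP, hHq⟩ := exists_quantile (μ.map h)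
  have hHP := MeasurePreserving.of_leftInverse hqP hH.measurable (ae_of_all _ hHq)
  have hqH := MeasurePreserving.ae_rightInverse_of_leftInverse hqP hH.measurable (ae_of_all _ hHq)
  have hgP := MeasurePreserving.of_leftInverse hhP hg (ae_of_all _ hgh')
  have hhg := MeasurePreserving.ae_rightInverse_of_leftInverse hhP hg (ae_of_all _ hgh')
  have hhq : ∀ᵐ t, h (g (q t)) = q t := hqP.quasiMeasurePreserving.ae hhg
  refine ⟨H, q, g ∘ q, hH, hq, hHP.comp hhP, hgP.comp hqP, ?_, ?_, hhq⟩
  · filter_upwards [hhP.quasiMeasurePreserving.ae hqH] with y hy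
    simp only [Function.comp_apply, hy, hgh']
  · filter_upwards [hhq] with t ht
    simp only [Function.comp_apply, ht, hHq]

/-- A countable product of two-point spaces embeds continuously in the unit interval. -/
lemma exists_continuous_injective_unitInterval {ι : Type*} (e : ι ≃ ℕ) :
    ∃ g : (ι → Fin 2) → unitInterval, Continuous g ∧ Function.Injective g := by
  set c : (ι → Fin 2) → ℕ → Bool := fun x n => finTwoEquiv (x (e.symm n)) with hc
  have hcc : Continuous c := by
    refine continuous_pi fun n => ?_
    exact continuous_of_discreteTopology.comp (continuous_apply _)
  have hci : Function.Injective c := fun x y h => by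
    ext i : 1
    have := congrFun h (e i)
    simpa [hc] using this
  have hsub : ∀ x : cantorSet, (x : ℝ) ∈ unitInterval := fun x => cantorSet_subset_unitInterval x.2
  refine ⟨fun x => ⟨cantorSetHomeomorphNatToBool.symm (c x), hsub _⟩, ?_, ?_⟩
  · exact (continuous_subtype_val.comp
      (cantorSetHomeomorphNatToBool.symm.continuous.comp hcc)).subtype_mk _
  · intro x y h
    simp only [Subtype.mk.injEq] at h
    exact hci (cantorSetHomeomorphNatToBool.symm.injective (Subtype.ext h))

/-- A bounded measurable function on a standard Borel space is a continuous function of some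
injective measurable coordinate. -/
lemma exists_injective_coordinate {X : Type*} [MeasurableSpace X] [StandardBorelSpace X]
    {f : X → ℝ} (hf : Measurable f) {C : ℝ} (hC : ∀ x, |f x| ≤ C) :
    ∃ (h : X → unitInterval) (W : unitInterval → ℝ), Measurable h ∧ Function.Injective h ∧
      Continuous W ∧ ∀ x, f x = W (h x) := by
  obtain ⟨d, hd, hdi⟩ := MeasurableSpace.measurable_injection_nat_bool_of_countablySeparated X
  obtain ⟨g, hg, hgi⟩ := exists_continuous_injective_unitInterval Equiv.natSumNatEquivNat
  -- The extra 1 keeps `u` strictly below 1, as binary expansion requires.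
  set D : ℝ := 2 * |C| + 1 with hD
  have hD0 : 0 < D := by positivity
  set u : X → ℝ := fun x => (f x + |C|) / D with hu
  have hum : ∀ x, u x ∈ Set.Ico (0 : ℝ) 1 := fun x => by
    have := abs_le.1 ((hC x).trans (le_abs_self C))
    refine ⟨div_nonneg (by linarith) hD0.le, ?_⟩
    rw [hu, div_lt_one hD0]
    linarith
  -- The first half of the digits determines `f` continuously; the second half separates points.
  -- Only digits-to-number must be continuous, so ambiguous expansions do no harm.
  set a : X → (ℕ ⊕ ℕ) → Fin 2 := fun x =>
    Sum.elim (Real.digits (u x) 2) (fun n => finTwoEquiv.symm (d x n)) with ha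
  have ham : Measurable a := by
    refine measurable_pi_iff.2 ?_
    rintro (n | n)
    · have hum : Measurable fun x => ⌊u x * 2 ^ (n + 1)⌋₊ :=
        Nat.measurable_floor.comp (((hf.add_const _).div_const _).mul_const _)
      simp only [ha, Sum.elim_inl, Real.digits]
      exact (measurable_of_countable (fun N : ℕ => Fin.ofNat 2 N)).comp (by exact_mod_cast hum)
    · simp only [ha, Sum.elim_inr]
      exact (measurable_of_countable finTwoEquiv.symm).comp ((measurable_pi_apply n).comp hd)
  have hai : Function.Injective a := fun x y hxy => hdi <| by
    ext n : 1
    have := congrFun hxy (Sum.inr n)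
    simpa [ha] using this
  set w : C((ℕ ⊕ ℕ) → Fin 2, ℝ) :=
    ⟨fun y => D * Real.ofDigits (fun n => y (Sum.inl n)) - |C|, by
      have := (Real.continuous_ofDigits (b := 2)).comp
        (by fun_prop : Continuous fun (y : (ℕ ⊕ ℕ) → Fin 2) (n : ℕ) => y (Sum.inl n))
      exact (continuous_const.mul this).sub continuous_const⟩ with hw
  -- Tietze extension from the compact image of `g`.
  obtain ⟨W, hW⟩ := ContinuousMap.exists_extension (hg.isClosedEmbedding hgi) w
  refine ⟨fun x => g (a x), W, hg.measurable.comp ham, hgi.comp hai, W.continuous, fun x => ?_⟩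
  have h1 : W (g (a x)) = w (a x) := by rw [← hW]; rfl
  have h2 : Real.ofDigits (fun n => a x (Sum.inl n)) = u x :=
    Real.ofDigits_digits (by norm_num) (hum x)
  rw [h1]
  simp only [hw, ContinuousMap.coe_mk, h2, hu]
  field_simp
  ring

/-! ### Transporting the shift and making `f` almost everywhere continuous -/

lemma measurePreserving_translate {k : ℕ} (p : PMF (Fin k)) (i : ℤ) :
    MeasurePreserving (fun (ω : ℤ → Fin k) j => ω (j + i)) (bernoulliMeasure p)
      (bernoulliMeasure p) :=
  ⟨by fun_prop, bernoulliMeasure_map_comp p (e := fun j => j + i) (add_left_injective i)⟩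

/-- The shift transported through an almost everywhere isomorphism can be realized by an
everywhere defined invertible transformation. -/
lemma exists_measurableEquiv_conj_shift {X : Type*} [MeasurableSpace X] [MeasurableEq X]
    {μ : Measure X} {k : ℕ} {p : PMF (Fin k)} {φ : X → ℤ → Fin k} {ψ : (ℤ → Fin k) → X}
    (hφ : MeasurePreserving φ μ (bernoulliMeasure p))
    (hψ : MeasurePreserving ψ (bernoulliMeasure p) μ)
    (hψφ : ∀ᵐ x ∂μ, ψ (φ x) = x) (hφψ : ∀ᵐ y ∂(bernoulliMeasure p), φ (ψ y) = y) :
    ∃ T : X ≃ᵐ X, MeasurePreserving T μ μ ∧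
      ∀ᵐ x ∂μ, ∀ i : ℤ, ((T.toEquiv : Equiv.Perm X) ^ i) x = ψ (fun j => φ x (j + i)) := by
  classical
  -- A conull set invariant under every `τ i`, on which the `τ i` compose as a `ℤ`-action; `T` is
  -- the identity off it.
  set G : Set X := {x | ψ (φ x) = x} ∩
    ⋂ i : ℤ, {x | φ (ψ (fun j => φ x (j + i))) = fun j => φ x (j + i)} with hG
  set τ : ℤ → X → X := fun i x => ψ (fun j => φ x (j + i)) with hτ
  have htr : ∀ i, Measurable fun x j => φ x (j + i) := fun i =>
    (measurePreserving_translate p i).measurable.comp hφ.measurable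
  have hτm : ∀ i, Measurable (τ i) := fun i => hψ.measurable.comp (htr i)
  have hGm : MeasurableSet G :=
    (measurableSet_eq_fun (hψ.measurable.comp hφ.measurable) measurable_id).inter
      (MeasurableSet.iInter fun i => measurableSet_eq_fun (hφ.measurable.comp (hτm i)) (htr i))
  have hGae : ∀ᵐ x ∂μ, x ∈ G := by
    have h := ae_all_iff.2 fun i : ℤ =>
      ((measurePreserving_translate p i).comp hφ).quasiMeasurePreserving.ae hφψ
    filter_upwards [hψφ, h] with x h1 h2
    exact ⟨h1, Set.mem_iInter.2 fun i => h2 i⟩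
  have hφτ : ∀ x ∈ G, ∀ i, φ (τ i x) = fun j => φ x (j + i) := fun x hx i =>
    Set.mem_iInter.1 hx.2 i
  have hττ : ∀ x ∈ G, ∀ i j, τ i (τ j x) = τ (i + j) x := fun x hx i j => by
    change ψ _ = ψ _
    rw [hφτ x hx]
    simp only [add_assoc]
  have hτ0 : ∀ x ∈ G, τ 0 x = x := fun x hx => by
    simpa [hτ] using hx.1
  have hτG : ∀ x ∈ G, ∀ i, τ i x ∈ G := fun x hx i => by
    refine ⟨?_, Set.mem_iInter.2 fun l => ?_⟩
    · change ψ (φ (τ i x)) = τ i x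
      rw [hφτ x hx]
    · change φ (τ l (τ i x)) = fun j => φ (τ i x) (j + l)
      rw [hττ x hx, hφτ x hx, hφτ x hx]
      simp only [add_assoc]
  have hinv : ∀ i : ℤ, Function.LeftInverse (G.piecewise (τ (-i)) id) (G.piecewise (τ i) id) := by
    intro i x
    by_cases hx : x ∈ G
    · rw [Set.piecewise_eq_of_mem _ _ _ hx, Set.piecewise_eq_of_mem _ _ _ (hτG x hx i),
        hττ x hx, neg_add_cancel, hτ0 x hx]
    · rw [Set.piecewise_eq_of_notMem _ _ _ hx, id, Set.piecewise_eq_of_notMem _ _ _ hx, id]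
  let T : X ≃ᵐ X :=
    { toFun := G.piecewise (τ 1) id
      invFun := G.piecewise (τ (-1)) id
      left_inv := hinv 1
      right_inv := fun x => by simpa using hinv (-1) x
      measurable_toFun := (hτm 1).piecewise hGm measurable_id
      measurable_invFun := (hτm (-1)).piecewise hGm measurable_id }
  have hT : ∀ x ∈ G, (T.toEquiv : Equiv.Perm X) x = τ 1 x := fun x hx =>
    Set.piecewise_eq_of_mem G (τ 1) id hx
  have hTinv : ∀ x ∈ G, ((T.toEquiv : Equiv.Perm X)⁻¹) x = τ (-1) x := fun x hx =>
    Set.piecewise_eq_of_mem G (τ (-1)) id hx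
  have hpow : ∀ i : ℤ, ∀ x ∈ G, ((T.toEquiv : Equiv.Perm X) ^ i) x = τ i x := by
    intro i
    induction i using Int.induction_on with
    | zero => intro x hx; simp [hτ0 x hx]
    | succ n ih =>
      intro x hx
      rw [zpow_add_one, Equiv.Perm.mul_apply, hT x hx, ih _ (hτG x hx 1), hττ x hx]
    | pred n ih =>
      intro x hx
      rw [zpow_sub_one, Equiv.Perm.mul_apply, hTinv x hx, ih _ (hτG x hx (-1)), hττ x hx,
        sub_eq_add_neg]
  refine ⟨T, ⟨T.measurable, ?_⟩, ?_⟩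
  · have hτP : μ.map (τ 1) = μ := (hψ.comp ((measurePreserving_translate p 1).comp hφ)).map_eq
    refine (Measure.map_congr ?_).trans hτP
    filter_upwards [hGae] with x hx using hT x hx
  · filter_upwards [hGae] with x hx i using hpow i x hx

lemma bernoulliMeasure_uniform_singleton (ω : ℤ → Fin 2) :
    bernoulliMeasure (PMF.uniformOfFintype (Fin 2)) {ω} = 0 := by
  refine le_antisymm (ENNReal.le_of_forall_pos_le_add fun ε hε _ => ?_) zero_le
  obtain ⟨n, hn⟩ := ENNReal.exists_inv_two_pow_lt (a := ε) (by exact_mod_cast hε.ne')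
  set s : Finset ℤ := (Finset.range n).map Nat.castEmbedding
  have hle : bernoulliMeasure (PMF.uniformOfFintype (Fin 2)) {ω} ≤
      bernoulliMeasure (PMF.uniformOfFintype (Fin 2)) (Set.pi s fun i => {ω i}) :=
    measure_mono (by rintro _ rfl i _; rfl)
  refine hle.trans ?_
  rw [bernoulliMeasure, Measure.infinitePi_pi _ fun i _ => measurableSet_singleton _]
  simp only [PMF.toMeasure_apply_singleton _ _ (measurableSet_singleton _),
    PMF.uniformOfFintype_apply, Fintype.card_fin, Finset.prod_const]
  rw [zero_add, Finset.card_map, Finset.card_range]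
  exact_mod_cast hn.le

instance : NullSingletonClass (bernoulliMeasure (PMF.uniformOfFintype (Fin 2))) :=
  ⟨bernoulliMeasure_uniform_singleton⟩

/-- Every bounded function on a diffuse standard probability space becomes almost everywhere
continuous in a suitable identification of the space with the fair-coin shift space. -/
lemma exists_iso_ae_continuousAt {X : Type*} [MeasurableSpace X] [StandardBorelSpace X]
    (μ : Measure X) [IsProbabilityMeasure μ] [NullSingletonClass μ]
    {f : X → ℝ} (hf : Measurable f) {C : ℝ} (hC : ∀ x, |f x| ≤ C) :
    ∃ (φ : X → ℤ → Fin 2) (ψ : (ℤ → Fin 2) → X) (V : (ℤ → Fin 2) → ℝ),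
      MeasurePreserving φ μ (bernoulliMeasure (PMF.uniformOfFintype (Fin 2))) ∧
      MeasurePreserving ψ (bernoulliMeasure (PMF.uniformOfFintype (Fin 2))) μ ∧
      (∀ᵐ x ∂μ, ψ (φ x) = x) ∧
      (∀ᵐ y ∂(bernoulliMeasure (PMF.uniformOfFintype (Fin 2))), φ (ψ y) = y) ∧
      (∃ D, ∀ ω, |V ω| ≤ D) ∧
      (∀ᵐ y ∂(bernoulliMeasure (PMF.uniformOfFintype (Fin 2))), ContinuousAt V y) ∧
      ∀ᵐ y ∂(bernoulliMeasure (PMF.uniformOfFintype (Fin 2))), f (ψ y) = V y := by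
  set P := bernoulliMeasure (PMF.uniformOfFintype (Fin 2))
  obtain ⟨h, W, hh, hhi, hW, hfW⟩ := exists_injective_coordinate hf hC
  obtain ⟨g, hg, hgi⟩ := exists_continuous_injective_unitInterval
    (Equiv.intEquivNat)
  obtain ⟨H₁, q₁, ψ₁, -, hq₁, hH₁P, hψ₁P, hψH₁, hHψ₁, hhψ₁⟩ := exists_unitInterval_iso μ hh hhi
  obtain ⟨H₂, q₂, ψ₂, hH₂, -, hH₂P, hψ₂P, hψH₂, hHψ₂, -⟩ :=
    exists_unitInterval_iso P hg.measurable hgi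
  -- Both isomorphisms pass through Lebesgue measure on the interval; in `V` only the monotone `q₁`
  -- can be discontinuous.
  refine ⟨fun x => ψ₂ (H₁ (h x)), fun ω => ψ₁ (H₂ (g ω)), fun ω => W (q₁ (H₂ (g ω))),
    hψ₂P.comp hH₁P, hψ₁P.comp hH₂P, ?_, ?_, ?_, ?_, ?_⟩
  · filter_upwards [hH₁P.quasiMeasurePreserving.ae hHψ₂, hψH₁] with x h1 h2
    rw [h1, h2]
  · filter_upwards [hH₂P.quasiMeasurePreserving.ae hHψ₁, hψH₂] with x h1 h2
    rw [h1, h2]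
  · obtain ⟨D, hD⟩ := (isCompact_range hW).isBounded.exists_norm_le
    exact ⟨D, fun ω => hD _ ⟨_, rfl⟩⟩
  · have hnull : ∀ᵐ t : unitInterval, ContinuousAt q₁ t := by
      filter_upwards [hq₁.countable_not_continuousAt.ae_notMem volume] with t ht
      simpa using ht
    filter_upwards [hH₂P.quasiMeasurePreserving.ae hnull] with y hy
    exact hW.continuousAt.comp (hy.comp (f := fun ω => H₂ (g ω)) (hH₂.comp hg).continuousAt)
  · filter_upwards [hH₂P.quasiMeasurePreserving.ae hhψ₁] with y hy
    rw [hfW, hy]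

theorem mainTheorem7 {X : Type*} [MeasurableSpace X] [StandardBorelSpace X]
    (μ : Measure X) [IsProbabilityMeasure μ] [NullSingletonClass μ]
    (f : X → ℝ) (hf : AEMeasurable f μ) (hbdd : ∃ C : ℝ, ∀ x, |f x| ≤ C) :
    ∃ T : X ≃ᵐ X, IsBernoulli μ T ∧
      ∀ α : ℝ, 1 / 2 < α →
        ∀ (v : ℕ → ℤ) (L : ℕ → ℕ), (∀ n : ℕ, 1 ≤ n → (n : ℝ) ^ α ≤ (L n : ℝ)) →
          ∀ᵐ x ∂μ, Tendsto (fun n => movingAverage T f (v n) (L n) x) atTop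
            (𝓝 (∫ y, f y ∂μ)) := by
  obtain ⟨C, hC⟩ := hbdd
  -- The measurable version of `f` may be unbounded on a null set, so it is truncated.
  set f' : X → ℝ := fun x => max (-|C|) (min |C| (hf.mk f x)) with hf'
  have hf'm : Measurable f' := measurable_const.max (measurable_const.min hf.measurable_mk)
  have hf'C : ∀ x, |f' x| ≤ |C| := fun x => abs_le.2
    ⟨le_max_left _ _, max_le (neg_le_self (abs_nonneg C)) (min_le_left _ _)⟩
  have hff' : ∀ᵐ x ∂μ, f x = f' x := by
    filter_upwards [hf.ae_eq_mk] with x hx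
    have := abs_le.1 ((hC x).trans (le_abs_self C))
    simp only [hf', ← hx, min_eq_right this.2, max_eq_right this.1]
  obtain ⟨φ, ψ, V, hφ, hψ, hψφ, hφψ, ⟨D, hD⟩, hVc, hV'⟩ := exists_iso_ae_continuousAt μ hf'm hf'C
  set p := PMF.uniformOfFintype (Fin 2)
  have hV : ∀ᵐ y ∂(bernoulliMeasure p), f (ψ y) = V y := by
    filter_upwards [hψ.quasiMeasurePreserving.ae hff', hV'] with y h1 h2
    rw [h1, h2]
  obtain ⟨T, hT, hTpow⟩ := exists_measurableEquiv_conj_shift hφ hψ hψφ hφψ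
  refine ⟨T, ⟨hT, 2, p, φ, ψ, hφ, hψ, hψφ, hφψ, ?_⟩, fun α hα v L hL => ?_⟩
  · filter_upwards [hTpow] with x hx
    have := hx 1
    rwa [zpow_one] at this
  have hint : ∫ y, f y ∂μ = ∫ ω, V ω ∂(bernoulliMeasure p) := by
    rw [← integral_congr_ae hV, ← hψ.map_eq, integral_map hψ.measurable.aemeasurable]
    rw [hψ.map_eq]
    exact hf.aestronglyMeasurable
  have hVtr := ae_all_iff.2 fun i : ℤ =>
    ((measurePreserving_translate p i).comp hφ).quasiMeasurePreserving.ae hV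
  have hconv := hφ.quasiMeasurePreserving.ae (ae_tendsto_average_of_ae_continuousAt p hD hVc hα v hL)
  filter_upwards [hTpow, hVtr, hconv] with x h1 h2 h3
  rw [hint]
  refine h3.congr fun n => ?_
  simp only [movingAverage, h1]
  congr 1
  exact Finset.sum_congr rfl fun i _ => (h2 i).symm
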